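/- Let $N,T\ge 1$, let $E\in\mathbb R^N$ and $\underline x,\overline x\in\mathbb R^{N\times T}$ be such that $$\mathcal X=\Big\{x\in\mathbb R^{NT}:\ \sum_{t}x_{n,t}=E_n\ \text{ and }\ \underline x_{n,t}\le x_{n,t}\le\overline x_{n,t}\ \text{ for all } n,t\Big\}\neq\emptyset ,$$ let $p\in\mathbb R^T$ with $\sum_t p_t=\sum_n E_n$, and let $\mathcal Y_p=\{y\in\mathbb R^{NT}: \sum_n y_{n,t}=p_t \text{ for all } t\}$. Let $(x^{(k)})_{k\ge 0},(y^{(k)})_{k\ge 0}$ be sequences generated by the alternate projections method (APM): $x^{(0)},y^{(0)}\in\mathbb R^{NT}$ are arbitrary and, for $k\ge 0$, $x^{(k+1)}=P_{\mathcal X}(y^{(k)})$ and $y^{(k+1)}=P_{\mathcal Y_p}(x^{(k+1)})$, where $P$ denotes Euclidean projection. Suppose that $x^{(k)}\to x^\infty$ and $y^{(k)}\to y^\infty$ with $x^\infty\ne y^\infty$, and let $\rho\in(0,1)$ be a geometric rate of the two sequences, that is, for all $k\ge 1$, $$\|x^{(k+1)}-x^{(k)}\|_2\le\rho\,\|x^{(k)}-x^{(k-1)}\|_2\quad\text{and}\quad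 \|y^{(k+1)}-y^{(k)}\|_2\le\rho\,\|y^{(k)}-y^{(k-1)}\|_2 .$$ For $k\ge1$ put $\nu^{(k)}=y^{(k)}_n-x^{(k)}_n\in\mathbb R^T$ and $\nu^\infty=y^\infty_n-x^\infty_n\in\mathbb R^T$, where $n$ is any agent in $\{1,\dots,N\}$ (these vectors do not depend on $n$), and let $\nu_{\min}=\min\{|\nu^\infty_t| : \nu^\infty_t\ne 0\}$. Let $c$ and $\varepsilon>0$ be real numbers with $$c>\frac1{1-\rho}\qquad\text{and}\qquad 2c\,\varepsilon<\nu_{\min},$$ and let $K$ be the iteration at which APM stops with tolerance $\varepsilon$, that is, the first $K\ge1$ with $\|x^{(K)}-x^{(K-1)}\|_2<\varepsilon$. Then, with $\mathcal T^{(K)}=\{t:\nu^{(K)}_t>c\,\varepsilon\}$ and $\mathcal T^\infty=\{t:\nu^\infty_t>0\}$, $$\mathcal T^{(K)}=\mathcal T^\infty ,$$ and the approximate cut $\sum_{t\in\mathcal T^{(K)}}p_t\le\sum_{t\in\mathcal T^{(K)}}\sum_n x^{(K)}_{n,t}$ is violated by $p$: $$\sum_{t\in\mathcal T^{(K)}}\sum_{n}x^{(K)}_{n,t}<\sum_{t\in\mathcal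 T^{(K)}}p_t .$$ -/

import Mathlib

open Filter Topology

namespace Disaggregation

/-- Profiles `x = (x_{n,t})` of `N` agents over `T` resources, with the Euclidean norm. -/
abbrev Profile (N T : ℕ) : Type := EuclideanSpace ℝ (Fin N × Fin T)

/-- The transportation-type feasibility set `X = X_1 × ⋯ × X_N`: agent `n` has total demand `E n`
and bounds `lo n t ≤ x_{n,t} ≤ hi n t`. -/
def agentSet {N T : ℕ} (E : Fin N → ℝ) (lo hi : Fin N → Fin T → ℝ) : Set (Profile N T) :=
  {x | ∀ n, (∑ t, x (n, t) = E n) ∧ ∀ t, lo n t ≤ x (n, t) ∧ x (n, t) ≤ hi n t}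

/-- The affine subspace `Y_p` of profiles that aggregate to `p`. -/
def aggregateSet {N T : ℕ} (p : Fin T → ℝ) : Set (Profile N T) :=
  {y | ∀ t, ∑ n, y (n, t) = p t}

/-- `x` is the Euclidean projection of `y` onto `C` (a nearest point of `C`; it is unique for
convex `C`, as are the two sets above). -/
def IsProj {N T : ℕ} (C : Set (Profile N T)) (y x : Profile N T) : Prop :=
  x ∈ C ∧ ∀ z ∈ C, ‖y - x‖ ≤ ‖y - z‖

/-- The infinite sequences of the alternate projections method on `X` and `Y`:
`x^(k+1) = P_X(y^(k))` and `y^(k+1) = P_Y(x^(k+1))`. The initial terms are arbitrary. -/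
def IsAPM {N T : ℕ} (X Y : Set (Profile N T)) (x y : ℕ → Profile N T) : Prop :=
  ∀ k, IsProj X (y k) (x (k + 1)) ∧ IsProj Y (x (k + 1)) (y (k + 1))

/-- `ρ ∈ (0,1)` is a geometric rate of the two sequences. -/
def IsGeometricRate {N T : ℕ} (x y : ℕ → Profile N T) (ρ : ℝ) : Prop :=
  0 < ρ ∧ ρ < 1 ∧ ∀ k, 1 ≤ k →
    ‖x (k + 1) - x k‖ ≤ ρ * ‖x k - x (k - 1)‖ ∧
    ‖y (k + 1) - y k‖ ≤ ρ * ‖y k - y (k - 1)‖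

/-- With tolerance `ε`, the method stops at iteration `K`: the first `K ≥ 1` with
`‖x^(K) - x^(K-1)‖ < ε`. -/
def StopsAt {N T : ℕ} (x : ℕ → Profile N T) (ε : ℝ) (K : ℕ) : Prop :=
  IsLeast {k : ℕ | 1 ≤ k ∧ ‖x k - x (k - 1)‖ < ε} K

/-- The multiplier `ν = y_n - x_n ∈ ℝ^T`, read off at agent `n`. -/
def multiplier {N T : ℕ} (n : Fin N) (x y : Profile N T) : Fin T → ℝ :=
  fun t => y (n, t) - x (n, t)

/-- The set `{t | a < ν_t}`. -/
noncomputable def superlevel {T : ℕ} (a : ℝ) (ν : Fin T → ℝ) : Finset (Fin T) :=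
  Finset.univ.filter fun t => a < ν t

/-- `A_S(x) = ∑_{t ∈ S} ∑_n x_{n,t}`, the right-hand side of the cut
`∑_{t ∈ S} p_t ≤ A_S(x)`. -/
def cutBound {N T : ℕ} (S : Finset (Fin T)) (x : Profile N T) : ℝ :=
  ∑ t ∈ S, ∑ n, x (n, t)

end Disaggregation

namespace Disaggregation

/-! For `k ≥ 1`, projecting onto the aggregate set gives `ν_t = (p_t - ∑ m, x_{m,t}) / N`, so each
entry of `ν` is a 1-Lipschitz function of `x`. The geometric rate and the stopping test bound `‖x K
- xinf‖` by `ε / (1 - ρ) < c * ε`, hence every entry of `ν` at `K` is within `c * ε` of its limit.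
Nonzero limit entries exceed `2 * c * ε` in absolute value, so the threshold `c * ε` isolates
exactly the positive ones. The cut is violated term by term, since `p_t - ∑ m, x_{m,t} = N * ν_t >
0` on the selected set. That set is nonempty because the limit multiplier is nonzero with zero sum.
-/

/-- The projection onto the aggregate set shifts every agent by the averaged aggregate defect. -/
theorem IsProj.sub_apply_of_aggregateSet {N T : ℕ} {p : Fin T → ℝ} {x y : Profile N T}
    (h : IsProj (aggregateSet p) x y) (n : Fin N) (t : Fin T) :
    y (n, t) - x (n, t) = (p t - ∑ m, x (m, t)) / N := by
  have hN : (N : ℝ) ≠ 0 := by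
    have := n.pos
    positivity
  set z : Profile N T :=
    WithLp.toLp 2 fun i => x i + (p i.2 - ∑ m, x (m, i.2)) / N with hz
  have hzx : ∀ i, z i = x i + (p i.2 - ∑ m, x (m, i.2)) / N := fun i => rfl
  have hzY : z ∈ aggregateSet p := fun s => by
    simp only [hzx, Finset.sum_add_distrib, Finset.sum_const, Finset.card_univ, Fintype.card_fin,
      nsmul_eq_mul]
    field_simp
    ring
  -- For fixed `s`, `x - z` does not depend on the agent, while `z - y` sums to zero over agents.
  have horth : inner ℝ (x - z) (z - y) = 0 := by
    rw [PiLp.inner_apply, Fintype.sum_prod_type_right]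
    refine Finset.sum_eq_zero fun s _ => ?_
    have hterm : ∀ m, inner ℝ ((x - z) (m, s)) ((z - y) (m, s)) =
        (z (m, s) - y (m, s)) * -((p s - ∑ m, x (m, s)) / N) := fun m => by
      simp [hzx]
    simp only [hterm]
    rw [← Finset.sum_mul, Finset.sum_sub_distrib, hzY s, h.1 s, sub_self, zero_mul]
  have hpyth : ‖x - y‖ * ‖x - y‖ = ‖x - z‖ * ‖x - z‖ + ‖z - y‖ * ‖z - y‖ := by
    have := norm_add_sq_eq_norm_sq_add_norm_sq_of_inner_eq_zero (x - z) (z - y) horth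
    rwa [sub_add_sub_cancel] at this
  have hle := mul_self_le_mul_self (norm_nonneg _) (h.2 z hzY)
  have hzy : z = y := by
    have : ‖z - y‖ * ‖z - y‖ = 0 := le_antisymm (by linarith) (mul_self_nonneg _)
    exact sub_eq_zero.1 (norm_eq_zero.1 (mul_self_eq_zero.1 this))
  rw [← hzy, hzx]
  ring

/-- Needed so that a nonzero limit multiplier has a positive entry. -/
theorem sum_multiplier_eq_zero {N T : ℕ} {E : Fin N → ℝ} {lo hi : Fin N → Fin T → ℝ}
    {p : Fin T → ℝ} (hp : ∑ t, p t = ∑ n, E n) {x y : Profile N T}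
    (hx : x ∈ agentSet E lo hi) (hy : IsProj (aggregateSet p) x y) (n : Fin N) :
    ∑ t, multiplier n x y t = 0 := by
  simp only [multiplier, hy.sub_apply_of_aggregateSet]
  rw [← Finset.sum_div, Finset.sum_sub_distrib, Finset.sum_comm (f := fun t m => x (m, t)),
    Finset.sum_congr rfl fun m _ => (hx m).1, hp, sub_self, zero_div]

/-- The difference is, up to sign, an average of `N` coordinates of `x - x'`, each at most the norm;
hence no factor `N`. -/
theorem abs_multiplier_sub_le {N T : ℕ} {p : Fin T → ℝ} {x y x' y' : Profile N T} (n : Fin N)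
    (t : Fin T) (h : multiplier n x y t = (p t - ∑ m, x (m, t)) / N)
    (h' : multiplier n x' y' t = (p t - ∑ m, x' (m, t)) / N) :
    |multiplier n x y t - multiplier n x' y' t| ≤ ‖x - x'‖ := by
  have hN : (0 : ℝ) < N := Nat.cast_pos.2 n.pos
  have hsum : multiplier n x y t - multiplier n x' y' t = -(∑ m, (x - x') (m, t)) / N := by
    simp only [h, h', PiLp.sub_apply, Finset.sum_sub_distrib]
    ring
  rw [hsum, abs_div, abs_neg, abs_of_pos hN, div_le_iff₀ hN]
  calc |∑ m, (x - x') (m, t)| ≤ ∑ m, |(x - x') (m, t)| := Finset.abs_sum_le_sum_abs _ _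
    _ ≤ ∑ _m : Fin N, ‖x - x'‖ := Finset.sum_le_sum fun m _ => PiLp.norm_apply_le (x - x') (m, t)
    _ = ‖x - x'‖ * N := by simp [mul_comm]

/-- A posteriori error bound for a geometrically convergent sequence. -/
theorem norm_sub_limit_le {F : Type*} [SeminormedAddCommGroup F] {x : ℕ → F} {a : F}
    {ρ : ℝ} (h0 : 0 ≤ ρ) (h1 : ρ < 1)
    (h : ∀ k, 1 ≤ k → ‖x (k + 1) - x k‖ ≤ ρ * ‖x k - x (k - 1)‖) (hx : Tendsto x atTop (𝓝 a))
    {K : ℕ} (hK : 1 ≤ K) : ‖x K - a‖ ≤ ‖x K - x (K - 1)‖ / (1 - ρ) := by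
  have hstep : ∀ j, ‖x (K + j) - x (K + j - 1)‖ ≤ ‖x K - x (K - 1)‖ * ρ ^ j := by
    intro j
    induction j with
    | zero => simp
    | succ j ih =>
      calc ‖x (K + j + 1) - x (K + j)‖ ≤ ρ * ‖x (K + j) - x (K + j - 1)‖ := h _ (by omega)
        _ ≤ ρ * (‖x K - x (K - 1)‖ * ρ ^ j) := mul_le_mul_of_nonneg_left ih h0
        _ = _ := by ring
  have hdist : ∀ j, dist (x (j + K)) (x (j + 1 + K)) ≤ ‖x K - x (K - 1)‖ * ρ ^ j := by
    intro j
    have h2 := h (K + j) (by omega)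
    rw [dist_comm, dist_eq_norm, add_comm j K, show j + 1 + K = K + j + 1 by ring]
    -- The spare factor `ρ` is dropped, giving `1 / (1 - ρ)` instead of `ρ / (1 - ρ)`.
    exact h2.trans ((mul_le_of_le_one_left (norm_nonneg _) h1.le).trans (hstep j))
  have := dist_le_of_le_geometric_of_tendsto ρ _ h1 hdist ((tendsto_add_atTop_iff_nat K).2 hx) 0
  simpa [dist_eq_norm] using this

theorem tendsto_multiplier {N T : ℕ} {x y : ℕ → Profile N T} {a b : Profile N T}
    (hx : Tendsto x atTop (𝓝 a)) (hy : Tendsto y atTop (𝓝 b)) (n : Fin N) (t : Fin T) :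
    Tendsto (fun k => multiplier n (x k) (y k) t) atTop (𝓝 (multiplier n a b t)) :=
  (((EuclideanSpace.proj (𝕜 := ℝ) (n, t)).continuous.tendsto b).comp hy).sub
    (((EuclideanSpace.proj (𝕜 := ℝ) (n, t)).continuous.tendsto a).comp hx)

end Disaggregation

open Disaggregation in
theorem mainTheorem4 {N T : ℕ}
    (E : Fin N → ℝ) (lo hi : Fin N → Fin T → ℝ) (p : Fin T → ℝ)
    (hp : ∑ t, p t = ∑ n, E n)
    (x y : ℕ → Disaggregation.Profile N T)
    (hAPM : Disaggregation.IsAPM (Disaggregation.agentSet E lo hi)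
      (Disaggregation.aggregateSet p) x y)
    (xinf yinf : Disaggregation.Profile N T)
    (hx : Tendsto x atTop (𝓝 xinf)) (hy : Tendsto y atTop (𝓝 yinf)) (hne : xinf ≠ yinf)
    (ρ : ℝ) (hρ : Disaggregation.IsGeometricRate x y ρ)
    (n : Fin N) (νmin : ℝ)
    (hνmin : IsLeast {a : ℝ | 0 < a ∧ ∃ t, a = |Disaggregation.multiplier n xinf yinf t|} νmin)
    (c ε : ℝ) (hε : 0 < ε) (hc : 1 / (1 - ρ) < c) (hcε : 2 * c * ε < νmin)
    (K : ℕ) (hK : Disaggregation.StopsAt x ε K) :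
    Disaggregation.superlevel (c * ε) (Disaggregation.multiplier n (x K) (y K)) =
        Disaggregation.superlevel 0 (Disaggregation.multiplier n xinf yinf) ∧
      Disaggregation.cutBound
          (Disaggregation.superlevel (c * ε) (Disaggregation.multiplier n (x K) (y K))) (x K) <
        ∑ t ∈ Disaggregation.superlevel (c * ε) (Disaggregation.multiplier n (x K) (y K)), p t := by
  obtain ⟨hρ0, hρ1, hrate⟩ := hρ
  obtain ⟨⟨hK1, hKε⟩, -⟩ := hK
  have hN : (0 : ℝ) < N := Nat.cast_pos.2 n.pos
  have hc0 : 0 < c := (one_div_pos.2 (sub_pos.2 hρ1)).trans hc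
  have hcε0 : 0 < c * ε := mul_pos hc0 hε
  have hν : ∀ k, 1 ≤ k → ∀ t,
      multiplier n (x k) (y k) t = (p t - ∑ m, x k (m, t)) / N := by
    intro k hk t
    obtain ⟨j, rfl⟩ := Nat.exists_eq_add_of_le' hk
    exact (hAPM j).2.sub_apply_of_aggregateSet n t
  have hlim := tendsto_multiplier hx hy n
  have hνinf : ∀ t, multiplier n xinf yinf t = (p t - ∑ m, xinf (m, t)) / N := by
    intro t
    -- The formula passes to the limit, so `yinf` need not be shown to be a projection.
    refine tendsto_nhds_unique ((hlim t).congr'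
      ((eventually_ge_atTop 1).mono fun k hk => hν k hk t)) ?_
    exact (tendsto_const_nhds.sub (tendsto_finsetSum _ fun m _ =>
      ((EuclideanSpace.proj (𝕜 := ℝ) (m, t)).continuous.tendsto xinf).comp hx)).div_const _
  have hsum : ∑ t, multiplier n xinf yinf t = 0 := by
    refine tendsto_nhds_unique (tendsto_finsetSum _ fun t _ => hlim t)
      (tendsto_const_nhds.congr' ((eventually_ge_atTop 1).mono fun k hk => ?_))
    obtain ⟨j, rfl⟩ := Nat.exists_eq_add_of_le' hk
    exact (sum_multiplier_eq_zero hp (hAPM j).1.1 (hAPM j).2 n).symm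
  have hclose : ‖x K - xinf‖ < c * ε := by
    refine (norm_sub_limit_le hρ0.le hρ1 (fun k hk => (hrate k hk).1) hx hK1).trans_lt ?_
    rw [div_eq_mul_one_div, mul_comm]
    exact mul_lt_mul'' hc hKε (one_div_pos.2 (sub_pos.2 hρ1)).le (norm_nonneg _)
  have hdiff : ∀ t, |multiplier n (x K) (y K) t - multiplier n xinf yinf t| < c * ε := fun t =>
    (abs_multiplier_sub_le n t (hν K hK1 t) (hνinf t)).trans_lt hclose
  have hset : superlevel (c * ε) (multiplier n (x K) (y K)) =
      superlevel 0 (multiplier n xinf yinf) := by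
    ext t
    simp only [superlevel, Finset.mem_filter, Finset.mem_univ, true_and]
    have hd := abs_lt.1 (hdiff t)
    constructor
    · intro h
      linarith
    · intro h
      have := hνmin.2 ⟨abs_pos.2 h.ne', t, rfl⟩
      rw [abs_of_pos h] at this
      linarith
  refine ⟨hset, ?_⟩
  have hnonempty : (superlevel (c * ε) (multiplier n (x K) (y K))).Nonempty := by
    -- `νmin` is attained, which supplies a nonzero entry of the limit multiplier.
    obtain ⟨hpos, t, rfl⟩ := hνmin.1
    obtain ⟨s, -, hs⟩ := Finset.exists_pos_of_sum_zero_of_exists_nonzero _ hsum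
      ⟨t, Finset.mem_univ t, abs_pos.1 hpos⟩
    rw [hset]
    exact ⟨s, by simpa [superlevel] using hs⟩
  refine Finset.sum_lt_sum_of_nonempty hnonempty fun t ht => ?_
  have hpos : 0 < multiplier n (x K) (y K) t :=
    hcε0.trans (by simpa [superlevel] using ht)
  rw [hν K hK1 t] at hpos
  exact sub_pos.1 ((div_pos_iff_of_pos_right hN).1 hpos)
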